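/- Let $N\ge 2$ be an integer, $\mathbb T=\mathbb R/\mathbb Z$ with Lebesgue measure $dt$, and let $\varphi\in L^2(\mathbb R)$, $\|\varphi\|=1$, be a scaling function, that is, for some complex coefficients $(a_k)_{k\in\mathbb Z}$, $$\varphi(x)=\sqrt N\sum_{k\in\mathbb Z}a_k\,\varphi(Nx-k)\quad\text{in }L^2(\mathbb R),\qquad m_0(t)=\sum_{k\in\mathbb Z}a_k e^{i2\pi kt}\quad\text{in }L^2(\mathbb T),$$ both series being limits of their symmetric partial sums. Let $\hat\varphi$ be the $L^2(\mathbb R)$-Fourier transform of $\varphi$ with kernel $e^{i2\pi xt}$ (so that $\hat\varphi(t)=N^{-1/2}m_0(t/N)\hat\varphi(t/N)$), and for functions $f\ge 0$ on $\mathbb T$ put $$(R_{m_0}f)(t)=\frac1N\sum_{k=0}^{N-1}\bigl(|m_0|^2f\bigr)\Bigl(\frac{t+k}N\Bigr),\qquad h_\varphi(t)=\sum_{n\in\mathbb Z}|\hat\varphi(t+n)|^2 .$$ Let $Sol_N(\mathbb T)=\{(x_n)_{n\ge0}\in\mathbb T^{\mathbb N_0}: N x_{n+1}=x_n\text{ for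 all }n\}$ with its cylinder $\sigma$-algebra and coordinate maps $\pi_n$, and let $\mathcal V_0\subset L^2(\mathbb R)$ be the space of all functions in $L^2(\mathbb R)$ of the form $f(t)\hat\varphi(t)$ with $f$ measurable and $1$-periodic. Then $R_{m_0}h_\varphi=h_\varphi$ almost everywhere, and there is a unique probability measure $\mathbb P$ on $Sol_N(\mathbb T)$ such that $$\int (f_0\circ\pi_0)(f_1\circ\pi_1)\cdots(f_n\circ\pi_n)\,d\mathbb P=\int_{\mathbb T}f_0\,R_{m_0}\bigl(f_1R_{m_0}(f_2\cdots R_{m_0}(f_nh_\varphi)\cdots)\bigr)\,dt$$ for all $n\ge0$ and all measurable $f_0,\dots,f_n\ge0$ on $\mathbb T$. For this $\mathbb P$: 1. $K_0: f(t)\hat\varphi(t)\mapsto f\circ\pi_0$ is a well-defined linear isometry from $\mathcal V_0$ into $L^2(Sol_N(\mathbb T),\mathbb P)$. 2. If $m_0\ne0$ almost everywhere on $\mathbb T$, then $K_0$ extends to a linear isometry from $L^2(\mathbb R)$ into $L^2(Sol_N(\mathbb T),\mathbb P)$. -/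

import Mathlib

open MeasureTheory Filter Topology
open scoped ENNReal FourierTransform

noncomputable section

/-- `φ ∈ L²(ℝ)` is a (normalized) scaling function of scale `N` with masking coefficients `a` and
filter `m₀`: `φ(x) = √N ∑ₖ aₖ φ(N x - k)` and `m₀(t) = ∑ₖ aₖ e^{2πikt}`, where both series are limits
of their symmetric partial sums, in `L²(ℝ)` and in `L²(ℝ/ℤ)` respectively. -/
structure IsScalingFunction (N : ℕ) (a : ℤ → ℂ) (m₀ : UnitAddCircle → ℂ)
    (φ : Lp ℂ 2 (volume : Measure ℝ)) : Prop where
  norm_eq_one : ‖φ‖ = 1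
  refinement : Tendsto
    (fun n : ℕ => eLpNorm
      (fun x : ℝ => φ x - (√(N : ℝ) : ℂ) *
        ∑ k ∈ Finset.Icc (-(n : ℤ)) (n : ℤ), a k * φ ((N : ℝ) * x - (k : ℝ)))
      2 (volume : Measure ℝ)) atTop (𝓝 0)
  filter_memLp : MemLp m₀ 2 (volume : Measure UnitAddCircle)
  filter_series : Tendsto
    (fun n : ℕ => eLpNorm
      (fun t : UnitAddCircle => m₀ t - ∑ k ∈ Finset.Icc (-(n : ℤ)) (n : ℤ), a k * fourier k t)
      2 (volume : Measure UnitAddCircle)) atTop (𝓝 0)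

/-- The `L²(ℝ)`-Fourier transform with kernel `e^{2πixt}`. This is the sign for which the filter
`m₀(t) = ∑ₖ aₖ e^{2πikt}` satisfies `φ̂(t) = N^{-1/2} m₀(t/N) φ̂(t/N)`; in Mathlib it is `𝓕⁻`. -/
def hat (φ : Lp ℂ 2 (volume : Measure ℝ)) : Lp ℂ 2 (volume : Measure ℝ) := 𝓕⁻ φ

/-- The representative in `[0,1)` of a point of `ℝ/ℤ`. -/
def circleRep (t : UnitAddCircle) : ℝ := (AddCircle.equivIco (1 : ℝ) 0 t : ℝ)

/-- The transfer operator `(R f)(t) = (1/N) ∑_{k<N} (|m₀|² f)((t+k)/N)` on nonnegative functions on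
`ℝ/ℤ`. The points `(t+k)/N mod 1`, `0 ≤ k < N`, are the solutions `s` of `N s = t`. -/
def transferOp (N : ℕ) (m₀ : UnitAddCircle → ℂ) (f : UnitAddCircle → ℝ≥0∞) :
    UnitAddCircle → ℝ≥0∞ :=
  fun t => (N : ℝ≥0∞)⁻¹ * ∑ k ∈ Finset.range N,
    ‖m₀ (((circleRep t + (k : ℝ)) / (N : ℝ) : ℝ) : UnitAddCircle)‖ₑ ^ 2 *
      f (((circleRep t + (k : ℝ)) / (N : ℝ) : ℝ) : UnitAddCircle)

/-- `h_φ(t) = ∑_{n ∈ ℤ} |φ̂(t+n)|²` on `ℝ/ℤ`. -/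
def hPhi (φ : Lp ℂ 2 (volume : Measure ℝ)) (t : UnitAddCircle) : ℝ≥0∞ :=
  ∑' n : ℤ, ‖hat φ (circleRep t + (n : ℝ))‖ₑ ^ 2

/-- The solenoid of the endomorphism `t ↦ N t` of `ℝ/ℤ`, with the cylinder sigma-algebra. -/
abbrev Solenoid (N : ℕ) : Type :=
  {x : ℕ → UnitAddCircle // ∀ n, N • x (n + 1) = x n}

/-- The coordinate map `πₙ` on the solenoid. -/
def coord {N : ℕ} (n : ℕ) (x : Solenoid N) : UnitAddCircle := x.1 n

/-- `f₀ R(f₁ R(f₂ ⋯ R(fₙ h) ⋯ ))`. -/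
def nested (R : (UnitAddCircle → ℝ≥0∞) → (UnitAddCircle → ℝ≥0∞)) (h : UnitAddCircle → ℝ≥0∞) :
    ℕ → (ℕ → UnitAddCircle → ℝ≥0∞) → UnitAddCircle → ℝ≥0∞
  | 0, f => fun x => f 0 x * h x
  | n + 1, f => fun x => f 0 x * R (nested R h n (fun k => f (k + 1))) x

/-- `P` is the path space measure on the solenoid determined by `R`, `h` and Lebesgue measure:
`∫ (f₀∘π₀)(f₁∘π₁)⋯(fₙ∘πₙ) dP = ∫ f₀ R(f₁ R(f₂ ⋯ R(fₙ h) ⋯ )) dt`. -/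
structure IsPathMeasure (N : ℕ) (R : (UnitAddCircle → ℝ≥0∞) → (UnitAddCircle → ℝ≥0∞))
    (h : UnitAddCircle → ℝ≥0∞) (P : Measure (Solenoid N)) : Prop where
  prob : IsProbabilityMeasure P
  path : ∀ (n : ℕ) (f : ℕ → UnitAddCircle → ℝ≥0∞), (∀ i, Measurable (f i)) →
    ∫⁻ ω, ∏ i ∈ Finset.range (n + 1), f i (coord i ω) ∂P =
      ∫⁻ t : UnitAddCircle, nested R h n f t

/-- The resolution space `V₀ ⊆ L²(ℝ)`, in the Fourier picture: all functions in `L²(ℝ)` of the form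
`f φ̂` with `f` measurable and 1-periodic. -/
def resolutionSpace (φ : Lp ℂ 2 (volume : Measure ℝ)) :
    Submodule ℂ (Lp ℂ 2 (volume : Measure ℝ)) where
  carrier := {g | ∃ f : UnitAddCircle → ℂ, Measurable f ∧
    g =ᵐ[volume] fun t : ℝ => f (t : UnitAddCircle) * hat φ t}
  add_mem' := by
    rintro g₁ g₂ ⟨f₁, hf₁, h₁⟩ ⟨f₂, hf₂, h₂⟩
    refine ⟨fun t => f₁ t + f₂ t, hf₁.add hf₂, ?_⟩
    filter_upwards [h₁, h₂, Lp.coeFn_add g₁ g₂] with t e₁ e₂ e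
    rw [e, Pi.add_apply, e₁, e₂, add_mul]
  zero_mem' := by
    refine ⟨fun _ => 0, measurable_const, ?_⟩
    filter_upwards [Lp.coeFn_zero ℂ 2 (volume : Measure ℝ)] with t e
    rw [e, Pi.zero_apply, zero_mul]
  smul_mem' := by
    rintro c g ⟨f, hf, h⟩
    refine ⟨fun t => c * f t, hf.const_mul c, ?_⟩
    filter_upwards [h, Lp.coeFn_smul c g] with t e₁ e
    rw [e, Pi.smul_apply, e₁, smul_eq_mul, mul_assoc]

end

noncomputable section

/-! The measure is explicit: push `|φ̂(x)|² dx` forward along the line `x ↦ (x, x/N, x/N², …)` mod 1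
in the solenoid. On periodizations, `R` acts through the line: `R (∑ₙ G(· + n))` is the
periodization of `N⁻¹ |m₀(x/N)|² G(x/N)` (`transferOp_periodize`). The refinement equation, Fourier
transformed (`IsScalingFunction.hat_eq`), says that `G = |φ̂|²` is fixed by this rule. Hence `R h =
h`, and the iterated expression collapses to the periodization of `∏ fᵢ(x/Nⁱ) |φ̂(x)|²`, whose
integral over the circle unfolds to one over `ℝ`. Cylinder sets give uniqueness.

The map `T F = (F ∘ line) · φ̂` is an isometry from `L²(P)` into `L²(ℝ)` whose range contains `V₀`,
and `K₀` is its inverse there. `T` need not be onto, since `φ̂` may vanish on a large set, so `K₀`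
is extended by sending `V₀ᗮ` isometrically into the vectors that `T` maps into `V₀ᗮ`. By
separability an infinite orthonormal sequence of such vectors suffices
(`exists_linearIsometry_rightInverse`). If `m₀ ≠ 0` a.e., the support of `φ̂` is invariant under
dilation by `N`, hence of infinite measure, and overlaps one of its nonzero integer translates.
Two-bump functions on disjoint pieces of the overlap are orthogonal to `V₀` and vanish where `φ̂`
does. As the line is injective, they lie in the range of `T`. -/

/-! ### Periodization and the transfer operator -/

theorem coe_circleRep (t : UnitAddCircle) : ((circleRep t : ℝ) : UnitAddCircle) = t :=
  (AddCircle.equivIco (1 : ℝ) 0).symm_apply_apply t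

theorem measurable_circleRep : Measurable circleRep :=
  measurable_subtype_coe.comp (AddCircle.measurableEquivIco (1 : ℝ) 0).measurable

theorem coe_add_intCast_unitAddCircle (x : ℝ) (n : ℤ) :
    ((x + n : ℝ) : UnitAddCircle) = (x : UnitAddCircle) := by
  rw [AddCircle.coe_add, add_eq_left, AddCircle.coe_eq_zero_iff]
  exact ⟨n, by simp⟩

theorem exists_circleRep_coe_eq (x : ℝ) : ∃ k : ℤ, circleRep (x : UnitAddCircle) = x + k := by
  have h := sub_eq_zero.2 (coe_circleRep (x : UnitAddCircle))
  rw [← AddCircle.coe_sub, AddCircle.coe_eq_zero_iff] at h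
  obtain ⟨k, hk⟩ := h
  refine ⟨k, ?_⟩
  rw [zsmul_eq_mul, mul_one] at hk
  linarith

/-- The sum of a nonnegative function over the integer translates of a point. -/
def periodize (G : ℝ → ℝ≥0∞) (t : UnitAddCircle) : ℝ≥0∞ := ∑' n : ℤ, G (circleRep t + (n : ℝ))

theorem periodize_coe (G : ℝ → ℝ≥0∞) (x : ℝ) :
    periodize G (x : UnitAddCircle) = ∑' n : ℤ, G (x + (n : ℝ)) := by
  obtain ⟨k, hk⟩ := exists_circleRep_coe_eq x
  rw [periodize, hk, ← (Equiv.addLeft k).tsum_eq (fun n : ℤ => G (x + (n : ℝ)))]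
  simp [add_assoc]

theorem measurable_periodize {G : ℝ → ℝ≥0∞} (hG : Measurable G) : Measurable (periodize G) :=
  Measurable.tsum fun _ => hG.comp (measurable_circleRep.add_const _)

theorem lintegral_periodize {G : ℝ → ℝ≥0∞} (hG : Measurable G) :
    ∫⁻ t : UnitAddCircle, periodize G t = ∫⁻ x : ℝ, G x := by
  rw [← UnitAddCircle.lintegral_preimage 0, ← setLIntegral_univ (f := G),
    ← iUnion_Ioc_add_intCast (0 : ℝ),
    lintegral_iUnion (fun _ => measurableSet_Ioc) (Set.pairwise_disjoint_Ioc_add_intCast 0)]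
  simp_rw [periodize_coe]
  rw [lintegral_tsum (f := fun (n : ℤ) x => G (x + n))
    fun _ => (hG.comp (measurable_id.add_const _)).aemeasurable]
  refine tsum_congr fun n => ?_
  have := (measurePreserving_add_right (volume : Measure ℝ) (n : ℝ)).setLIntegral_comp_preimage_emb
    (measurableEmbedding_addRight (n : ℝ)) G (Set.Ioc (0 + (n : ℝ)) (0 + n + 1))
  rw [← this]
  congr 2
  ext x
  simp only [Set.mem_preimage, Set.mem_Ioc]
  constructor <;> rintro ⟨h1, h2⟩ <;> constructor <;> linarith

/-- The periodized indicator of a null set has integral zero, so almost every fibre `t + ℤ` misses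
the exceptional set entirely. -/
theorem periodize_ae_congr {G G' : ℝ → ℝ≥0∞} (h : G =ᵐ[volume] G') :
    periodize G =ᵐ[volume] periodize G' := by
  obtain ⟨s, hs, hsm, hs0⟩ := exists_measurable_superset_of_null (ae_iff.1 h)
  have h1 : ∫⁻ t : UnitAddCircle, periodize (s.indicator 1) t = 0 := by
    rw [lintegral_periodize (measurable_one.indicator hsm), lintegral_indicator_one hsm, hs0]
  rw [lintegral_eq_zero_iff (measurable_periodize (measurable_one.indicator hsm))] at h1
  filter_upwards [h1] with t ht
  refine tsum_congr fun n => ?_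
  have := ENNReal.tsum_eq_zero.1 ht n
  by_contra hne
  exact one_ne_zero ((Set.indicator_of_mem (hs hne) 1).symm.trans this)

theorem quasiMeasurePreserving_coe_unitAddCircle :
    Measure.QuasiMeasurePreserving (fun x : ℝ => (x : UnitAddCircle)) volume volume := by
  refine ⟨AddCircle.measurable_mk', Measure.AbsolutelyContinuous.mk fun s hs h0 => ?_⟩
  have hm : MeasurableSet ((fun x : ℝ => (x : UnitAddCircle)) ⁻¹' s) := AddCircle.measurable_mk' hs
  rw [Measure.map_apply AddCircle.measurable_mk' hs, ← lintegral_indicator_one hm,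
    ← lintegral_periodize (measurable_one.indicator hm)]
  rw [lintegral_congr_ae (g := 0), Pi.zero_def, lintegral_zero]
  filter_upwards [measure_eq_zero_iff_ae_notMem.1 h0] with t ht
  refine ENNReal.tsum_eq_zero.2 fun n => Set.indicator_of_notMem ?_ _
  have : ((circleRep t + n : ℝ) : UnitAddCircle) = t := by
    rw [coe_add_intCast_unitAddCircle, coe_circleRep]
  simpa [this] using ht

theorem quasiMeasurePreserving_div {c : ℝ} (hc : c ≠ 0) :
    Measure.QuasiMeasurePreserving (fun x : ℝ => x / c) volume volume := by
  refine ⟨measurable_id.div_const c, ?_⟩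
  have h : (fun x : ℝ => x / c) = fun x => x * c⁻¹ := funext fun x => div_eq_mul_inv x c
  rw [h, Real.map_volume_mul_right (inv_ne_zero hc)]
  exact Measure.smul_absolutelyContinuous

theorem mul_periodize (f : UnitAddCircle → ℝ≥0∞) (G : ℝ → ℝ≥0∞) (t : UnitAddCircle) :
    f t * periodize G t = periodize (fun x => f (x : UnitAddCircle) * G x) t := by
  rw [periodize, periodize, ← ENNReal.tsum_mul_left]
  refine tsum_congr fun n => ?_
  rw [coe_add_intCast_unitAddCircle, coe_circleRep]

/-- Division with remainder: each integer is `k + N m` for a unique `0 ≤ k < N`, so the sum over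
branches `k` and translates `m` is a single sum over `ℤ`. -/
theorem transferOp_periodize {N : ℕ} (hN : N ≠ 0) (m₀ : UnitAddCircle → ℂ) (G : ℝ → ℝ≥0∞) :
    transferOp N m₀ (periodize G) =
      periodize fun x => (N : ℝ≥0∞)⁻¹ * (‖m₀ ((x / N : ℝ) : UnitAddCircle)‖ₑ ^ 2 * G (x / N)) := by
  have : NeZero N := ⟨hN⟩
  have hN' : (N : ℝ) ≠ 0 := Nat.cast_ne_zero.2 hN
  funext t
  rw [transferOp, periodize, ENNReal.tsum_mul_left]
  congr 1
  have e := (Int.divModEquiv N).symm.tsum_eq fun n : ℤ =>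
    ‖m₀ (((circleRep t + n) / N : ℝ) : UnitAddCircle)‖ₑ ^ 2 * G ((circleRep t + n) / N)
  rw [← e, ENNReal.tsum_prod', ENNReal.tsum_comm, tsum_fintype, Finset.sum_range]
  refine Finset.sum_congr rfl fun k _ => ?_
  rw [mul_periodize (fun s => ‖m₀ s‖ₑ ^ 2), periodize_coe]
  refine tsum_congr fun m => ?_
  have : (circleRep t + k) / N + m = (circleRep t + ((Int.divModEquiv N).symm (m, k) : ℤ)) / N := by
    simp [Int.divModEquiv]
    field_simp
    ring
  rw [this]

/-! ### The refinement equation on the Fourier side -/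

theorem map_volume_mul_add {c : ℝ} (hc : c ≠ 0) (b : ℝ) :
    Measure.map (fun x : ℝ => c * x + b) volume = ENNReal.ofReal |c⁻¹| • volume := by
  have h : (fun x : ℝ => c * x + b) = (fun x => x + b) ∘ (fun x => c * x) := rfl
  rw [h, ← Measure.map_map (measurable_add_const b) (measurable_const_mul c),
    Real.map_volume_mul_left hc, Measure.map_smul,
    (measurePreserving_add_right volume b).map_eq]

/-- Bounded weighted composition with an affine map is a bounded operator on `L²(ℝ)`. -/
theorem exists_weightedComp (u : ℝ → ℂ) (hu : Measurable u) (hu1 : ∀ x, ‖u x‖ ≤ 1) {c : ℝ}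
    (hc : c ≠ 0) (b : ℝ) :
    ∃ W : Lp ℂ 2 (volume : Measure ℝ) →L[ℂ] Lp ℂ 2 (volume : Measure ℝ),
      ∀ f, W f =ᵐ[volume] fun x => u x * f (c * x + b) := by
  have hT : Measurable fun x : ℝ => c * x + b := by fun_prop
  have hcomp (f : Lp ℂ 2 (volume : Measure ℝ)) : MemLp (fun x => f (c * x + b)) 2 volume := by
    refine MemLp.comp_of_map (g := f) ?_ hT.aemeasurable
    rw [map_volume_mul_add hc]
    exact (Lp.memLp f).smul_measure ENNReal.ofReal_ne_top
  have hle (f : Lp ℂ 2 (volume : Measure ℝ)) (x : ℝ) :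
      ‖u x * f (c * x + b)‖ ≤ ‖f (c * x + b)‖ := by
    rw [norm_mul]; exact mul_le_of_le_one_left (norm_nonneg _) (hu1 x)
  have hmem (f : Lp ℂ 2 (volume : Measure ℝ)) :
      MemLp (fun x => u x * f (c * x + b)) 2 volume :=
    (hcomp f).of_le (hu.aestronglyMeasurable.mul (hcomp f).1) (.of_forall (hle f))
  have hq : Measure.QuasiMeasurePreserving (fun x : ℝ => c * x + b) volume volume :=
    ⟨hT, by rw [map_volume_mul_add hc]; exact Measure.smul_absolutelyContinuous⟩
  let W : Lp ℂ 2 (volume : Measure ℝ) →ₗ[ℂ] Lp ℂ 2 (volume : Measure ℝ) :=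
    { toFun := fun f => (hmem f).toLp
      map_add' := fun f g => by
        refine Lp.ext ?_
        filter_upwards [(hmem (f + g)).coeFn_toLp, (hmem f).coeFn_toLp, (hmem g).coeFn_toLp,
          Lp.coeFn_add (hmem f).toLp (hmem g).toLp, hq.ae (Lp.coeFn_add f g)] with x h1 h2 h3 h4 h5
        rw [h1, h4, Pi.add_apply, h2, h3, h5, Pi.add_apply, mul_add]
      map_smul' := fun r f => by
        refine Lp.ext ?_
        filter_upwards [(hmem (r • f)).coeFn_toLp, (hmem f).coeFn_toLp,
          Lp.coeFn_smul r (hmem f).toLp, hq.ae (Lp.coeFn_smul r f)] with x h1 h2 h4 h5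
        rw [h1, RingHom.id_apply, h4, Pi.smul_apply, h2, h5, Pi.smul_apply, smul_eq_mul,
          smul_eq_mul, mul_left_comm] }
  refine ⟨W.mkContinuous (ENNReal.ofReal |c⁻¹| ^ (1 / 2 : ℝ≥0∞).toReal).toReal fun f => ?_,
    fun f => (hmem f).coeFn_toLp⟩
  change ‖(hmem f).toLp‖ ≤ _
  rw [Lp.norm_toLp, Lp.norm_def, ← ENNReal.toReal_mul, ← smul_eq_mul,
    ← eLpNorm_smul_measure_of_ne_top (by simp), ← map_volume_mul_add hc b,
    eLpNorm_map_measure (by rw [map_volume_mul_add hc]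
                            exact (Lp.aestronglyMeasurable f).smul_measure _) hT.aemeasurable]
  exact ENNReal.toReal_mono (hcomp f).2.ne (eLpNorm_mono (hle f))

theorem fourierInv_comp_mul_sub (g : ℝ → ℂ) {c : ℝ} (hc : 0 < c) (b w : ℝ) :
    𝓕⁻ (fun x => g (c * x - b)) w = (c : ℂ)⁻¹ * (Real.fourierChar (b * w / c) * 𝓕⁻ g (w / c)) := by
  have h1 := Measure.integral_comp_mul_left
    (fun y : ℝ => (Real.fourierChar (y * w / c) : ℂ) * g (y - b)) c
  have h2 := integral_sub_right_eq_self
    (fun y : ℝ => (Real.fourierChar ((y + b) * w / c) : ℂ) * g y) (μ := volume) b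
  rw [Real.fourierInv_eq, Real.fourierInv_eq, ← integral_const_mul]
  simp only [Circle.smul_def, smul_eq_mul, RCLike.inner_apply, conj_trivial]
  simp only [sub_add_cancel] at h2
  rw [h2] at h1
  have e1 : ∀ x : ℝ, c * x * w / c = w * x := fun x => by field_simp
  simp only [e1] at h1
  rw [h1, abs_of_pos (inv_pos.2 hc), Complex.real_smul, Complex.ofReal_inv]
  congr 1
  refine integral_congr_ae (.of_forall fun y => ?_)
  have e2 : (y + b) * w / c = b * w / c + w / c * y := by ring
  simp only [e2, AddChar.map_add_eq_mul, Circle.coe_mul, mul_assoc]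

/-- Both sides are continuous in `f`, so Schwartz functions suffice, where the integral formula
applies. The bound `1 ≤ c` makes the affine map antilipschitz with constant 1, which keeps the
composition Schwartz. -/
theorem fourierInv_weightedComp {c : ℝ} (hc : 1 ≤ c) (b : ℝ)
    {W₁ W₂ : Lp ℂ 2 (volume : Measure ℝ) →L[ℂ] Lp ℂ 2 (volume : Measure ℝ)}
    (h₁ : ∀ f, W₁ f =ᵐ[volume] fun x => 1 * f (c * x + -b))
    (h₂ : ∀ f, W₂ f =ᵐ[volume] fun x =>
      ((c : ℂ)⁻¹ * Real.fourierChar (b * x / c)) * f (c⁻¹ * x + 0))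
    (f : Lp ℂ 2 (volume : Measure ℝ)) : 𝓕⁻ (W₁ f) = W₂ (𝓕⁻ f) := by
  have hc0 : 0 < c := by linarith
  have hq : Measure.QuasiMeasurePreserving (fun x : ℝ => c * x + -b) volume volume :=
    ⟨by fun_prop, by rw [map_volume_mul_add hc0.ne']; exact Measure.smul_absolutelyContinuous⟩
  have hq' : Measure.QuasiMeasurePreserving (fun x : ℝ => c⁻¹ * x + 0) volume volume :=
    ⟨by fun_prop, by
      rw [map_volume_mul_add (inv_ne_zero hc0.ne')]; exact Measure.smul_absolutelyContinuous⟩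
  refine DenseRange.induction_on (p := fun f => 𝓕⁻ (W₁ f) = W₂ (𝓕⁻ f))
    (SchwartzMap.denseRange_toLpCLM (p := 2) ENNReal.ofNat_ne_top) f
    (isClosed_eq ((Lp.fourierTransformₗᵢ ℝ ℂ).symm.continuous.comp W₁.continuous)
      (W₂.continuous.comp (Lp.fourierTransformₗᵢ ℝ ℂ).symm.continuous)) fun g => ?_
  let g' : SchwartzMap ℝ ℂ := SchwartzMap.compCLMOfAntilipschitz ℂ (K := 1)
    (g := fun x : ℝ => c * x + -b) (by fun_prop) (AntilipschitzWith.of_le_mul_dist fun x y => by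
      rw [Real.dist_eq, Real.dist_eq, add_sub_add_right_eq_sub, ← mul_sub, abs_mul,
        abs_of_pos hc0, NNReal.coe_one, one_mul]
      exact le_mul_of_one_le_left (abs_nonneg _) hc) g
  have hg' : W₁ (g.toLp 2) = g'.toLp 2 := by
    refine Lp.ext ?_
    filter_upwards [h₁ (g.toLp 2), g'.coeFn_toLp 2,
      hq.ae (p := fun y => g.toLp 2 volume y = g y) (g.coeFn_toLp 2 volume)] with x e1 e2 e3
    rw [e1, e2, e3, one_mul]
    rfl
  rw [SchwartzMap.toLpCLM_apply, hg', SchwartzMap.toLp_fourierInv_eq,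
    SchwartzMap.toLp_fourierInv_eq]
  refine Lp.ext ?_
  filter_upwards [h₂ ((𝓕⁻ g).toLp 2), (𝓕⁻ g').coeFn_toLp 2,
    hq'.ae (p := fun y => (𝓕⁻ g).toLp 2 volume y = (𝓕⁻ g) y)
      ((𝓕⁻ g).coeFn_toLp 2 volume)] with x e1 e2 e3
  refine e2.trans (Eq.trans ?_ e1.symm)
  rw [e3, SchwartzMap.fourierInv_coe, SchwartzMap.fourierInv_coe, add_zero,
    inv_mul_eq_div c x, mul_assoc]
  exact fourierInv_comp_mul_sub g hc0 b x

theorem coe_fourierChar_div (k : ℤ) (x c : ℝ) :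
    (Real.fourierChar (k * x / c) : ℂ) = fourier k ((x / c : ℝ) : UnitAddCircle) := by
  rw [fourier_coe_apply, Real.fourierChar_apply]
  congr 1
  push_cast
  ring

theorem coeFn_smul_sum_smul {ι : Type*} (c : ℂ) (s : Finset ι) (a : ι → ℂ)
    (F : ι → Lp ℂ 2 (volume : Measure ℝ)) :
    (c • ∑ k ∈ s, a k • F k : Lp ℂ 2 (volume : Measure ℝ)) =ᵐ[volume]
      fun x => c * ∑ k ∈ s, a k * F k x := by
  classical
  have h : (∑ k ∈ s, a k • F k : Lp ℂ 2 (volume : Measure ℝ)) =ᵐ[volume]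
      fun x => ∑ k ∈ s, a k * F k x := by
    induction s using Finset.induction_on with
    | empty => simpa using! Lp.coeFn_zero ℂ 2 (volume : Measure ℝ)
    | insert i s hi ih =>
      rw [Finset.sum_insert hi]
      filter_upwards [Lp.coeFn_add (a i • F i) (∑ k ∈ s, a k • F k), Lp.coeFn_smul (a i) (F i), ih]
        with x e1 e2 e3
      rw [e1, Pi.add_apply, e2, e3, Finset.sum_insert hi, Pi.smul_apply, smul_eq_mul]
  filter_upwards [h, Lp.coeFn_smul c (∑ k ∈ s, a k • F k)] with x e1 e2
  rw [e2, Pi.smul_apply, e1, smul_eq_mul]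

/-- The Fourier form of the refinement equation. -/
theorem IsScalingFunction.hat_eq {N : ℕ} (hN : N ≠ 0) {a : ℤ → ℂ} {m₀ : UnitAddCircle → ℂ}
    {φ : Lp ℂ 2 (volume : Measure ℝ)} (hφ : IsScalingFunction N a m₀ φ) :
    ∀ᵐ x : ℝ, hat φ x =
      (√(N : ℝ) : ℂ)⁻¹ * m₀ ((x / N : ℝ) : UnitAddCircle) * hat φ (x / N) := by
  have hN1 : (1 : ℝ) ≤ N := by exact_mod_cast Nat.one_le_iff_ne_zero.2 hN
  have hN0 : (0 : ℝ) < N := by linarith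
  choose W₁ hW₁ using fun k : ℤ => exists_weightedComp (fun _ => 1) measurable_const (by simp)
    hN0.ne' (-(k : ℝ))
  choose W₂ hW₂ using fun k : ℤ => exists_weightedComp
    (fun x => ((N : ℝ) : ℂ)⁻¹ * (Real.fourierChar ((k : ℝ) * x / N) : ℂ))
    (by fun_prop)
    (fun x => by
      rw [norm_mul, Circle.norm_coe, mul_one, norm_inv, Complex.norm_real, Real.norm_of_nonneg hN0.le]
      exact inv_le_one_of_one_le₀ hN1) (inv_ne_zero hN0.ne') 0
  let S (n : ℕ) : Lp ℂ 2 (volume : Measure ℝ) :=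
    (√(N : ℝ) : ℂ) • ∑ k ∈ Finset.Icc (-(n : ℤ)) (n : ℤ), a k • W₁ k φ
  have hS : Tendsto S atTop (𝓝 φ) := by
    rw [Lp.tendsto_Lp_iff_tendsto_eLpNorm']
    refine hφ.refinement.congr fun n => ?_
    rw [← eLpNorm_neg]
    refine eLpNorm_congr_ae ?_
    filter_upwards [coeFn_smul_sum_smul (√(N : ℝ) : ℂ) (Finset.Icc (-(n : ℤ)) (n : ℤ)) a
      fun k => W₁ k φ, ae_all_iff.2 fun k => hW₁ k φ] with x e1 e2
    rw [Pi.sub_apply, e1, Pi.neg_apply, neg_sub]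
    simp only [e2, one_mul, ← sub_eq_add_neg]
  have hS' := ((Lp.fourierTransformₗᵢ ℝ ℂ).symm.continuous.tendsto φ).comp hS
  have hT (n : ℕ) : (Lp.fourierTransformₗᵢ ℝ ℂ).symm (S n) =
      (√(N : ℝ) : ℂ) • ∑ k ∈ Finset.Icc (-(n : ℤ)) (n : ℤ), a k • W₂ k (hat φ) := by
    simp only [S, map_smul, map_sum]
    congr 1
    refine Finset.sum_congr rfl fun k _ => ?_
    congr 1
    exact fourierInv_weightedComp hN1 k (hW₁ k) (hW₂ k) φ
  have hT' (n : ℕ) : (Lp.fourierTransformₗᵢ ℝ ℂ).symm (S n) =ᵐ[volume] fun x : ℝ =>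
      (√(N : ℝ) : ℂ)⁻¹ * (∑ k ∈ Finset.Icc (-(n : ℤ)) (n : ℤ),
        a k * fourier k ((x / N : ℝ) : UnitAddCircle)) * hat φ (x / N) := by
    rw [hT n]
    filter_upwards [coeFn_smul_sum_smul (√(N : ℝ) : ℂ) (Finset.Icc (-(n : ℤ)) (n : ℤ)) a
      fun k => W₂ k (hat φ), ae_all_iff.2 fun k => hW₂ k (hat φ)] with x e1 e2
    rw [e1]
    have hs : (√(N : ℝ) : ℂ)⁻¹ = (√(N : ℝ) : ℂ) * ((N : ℝ) : ℂ)⁻¹ := by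
      have h0 : (√(N : ℝ) : ℂ) ≠ 0 := by
        rw [Complex.ofReal_ne_zero]; exact (Real.sqrt_pos.2 hN0).ne'
      have h3 : ((N : ℝ) : ℂ) = (√(N : ℝ) : ℂ) * (√(N : ℝ) : ℂ) := by
        rw [← Complex.ofReal_mul, Real.mul_self_sqrt hN0.le]
      rw [h3]
      field_simp
    rw [hs, mul_assoc, mul_assoc, Finset.sum_mul]
    congr 1
    rw [Finset.mul_sum]
    refine Finset.sum_congr rfl fun k _ => ?_
    rw [e2, coe_fourierChar_div, add_zero, inv_mul_eq_div]
    ring_nf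
  obtain ⟨ns, hns, h1⟩ := (tendstoInMeasure_of_tendsto_eLpNorm two_ne_zero
    (f := fun (n : ℕ) (t : UnitAddCircle) =>
      ∑ k ∈ Finset.Icc (-(n : ℤ)) (n : ℤ), a k * fourier k t) (g := m₀)
    (fun n => (by fun_prop : Continuous _).aestronglyMeasurable) hφ.filter_memLp.1
    (hφ.filter_series.congr fun n => by rw [← eLpNorm_neg]; congr 1; ext t; simp)
    ).exists_seq_tendsto_ae
  -- The second subsequence is extracted from the first, so that the filter series and the
  -- transformed sums converge almost everywhere along the same indices.
  obtain ⟨ms, hms, h2⟩ := (tendstoInMeasure_of_tendsto_Lp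
    (hS'.comp hns.tendsto_atTop)).exists_seq_tendsto_ae
  have hq := quasiMeasurePreserving_coe_unitAddCircle.comp (quasiMeasurePreserving_div hN0.ne')
  filter_upwards [hq.ae h1, h2, ae_all_iff.2 hT'] with x e1 e2 e3
  refine tendsto_nhds_unique e2 ?_
  simp only [Function.comp_apply, e3]
  exact ((e1.comp hms.tendsto_atTop).const_mul _).mul_const _

/-! ### Extending isometries between Hilbert spaces -/

/-- Separability makes a Hilbert basis countable, because balls of radius `1/2` about its vectors
are disjoint. Its vectors can then be sent to distinct `e n`. -/
theorem exists_linearIsometry_of_orthonormal_nat {H W : Type*} [NormedAddCommGroup H]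
    [InnerProductSpace ℂ H] [CompleteSpace H] [TopologicalSpace.SeparableSpace H]
    [NormedAddCommGroup W] [InnerProductSpace ℂ W] [CompleteSpace W]
    {e : ℕ → W} (he : Orthonormal ℂ e) : ∃ _ : H →ₗᵢ[ℂ] W, True := by
  obtain ⟨w, b, hb⟩ := exists_hilbertBasis ℂ H
  have hw : Countable w := by
    have hd (i j : w) (hij : i ≠ j) : 1 ≤ dist (b i) (b j) := by
      have h1 : ‖b i - b j‖ ^ 2 = 2 := by
        rw [@norm_sub_sq ℂ, b.orthonormal.1 i, b.orthonormal.1 j, b.orthonormal.2 hij, map_zero]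
        norm_num
      rw [dist_eq_norm]
      exact (one_le_sq_iff₀ (norm_nonneg _)).1 (by rw [h1]; norm_num)
    refine Pairwise.countable_of_isOpen_disjoint (s := fun i : w => Metric.ball (b i) (1 / 2))
      (fun i j hij => Metric.ball_disjoint_ball (by linarith [hd i j hij]))
      (fun _ => Metric.isOpen_ball) fun i => ⟨b i, Metric.mem_ball_self (by norm_num)⟩
  obtain ⟨g, hg⟩ := hw.exists_injective_nat
  have hV := (he.comp g hg).orthogonalFamily
  exact ⟨hV.linearIsometry.comp b.repr.toLinearIsometry, trivial⟩

/-- An isometry between Hilbert spaces can be inverted on a subspace of its range, the inverse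
being extended isometrically to the whole space, if there is enough room for the complement. -/
theorem exists_linearIsometry_rightInverse {H H' : Type*} [NormedAddCommGroup H]
    [InnerProductSpace ℂ H] [CompleteSpace H] [TopologicalSpace.SeparableSpace H]
    [NormedAddCommGroup H'] [InnerProductSpace ℂ H'] [CompleteSpace H']
    (T : H' →ₗᵢ[ℂ] H) {V : Submodule ℂ H} (hV : V ≤ T.range)
    {e : ℕ → H'} (he : Orthonormal ℂ e) (heV : ∀ n, T (e n) ∈ Vᗮ) :
    ∃ K : H →ₗᵢ[ℂ] H', ∀ v ∈ V, T (K v) = v := by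
  have hcl : IsClosed (T.range : Set H) := T.isometry.isClosedEmbedding.isClosed_range
  let V' := V.topologicalClosure
  have hV' : V' ≤ T.range := V.topologicalClosure_minimal hV hcl
  have : CompleteSpace V' := V.isClosed_topologicalClosure.completeSpace_coe
  -- Room for the image of `V'ᗮ`: `T` takes `W` into `V'ᗮ`, so `W` is orthogonal to the image of
  -- `V'` under `T⁻¹`.
  let W : Submodule ℂ H' := (V'ᗮ).comap T.toLinearMap
  have : CompleteSpace W :=
    ((V'.isClosed_orthogonal).preimage T.continuous).completeSpace_coe
  have heW : ∀ n, e n ∈ W := fun n => by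
    change T (e n) ∈ V'ᗮ
    rw [Submodule.orthogonal_closure]
    exact heV n
  have he' : Orthonormal ℂ fun n => (⟨e n, heW n⟩ : W) := by
    rw [← W.subtypeₗᵢ.orthonormal_comp_iff]
    exact he
  obtain ⟨J, -⟩ := exists_linearIsometry_of_orthonormal_nat (H := V'ᗮ) he'
  let S : V' →ₗᵢ[ℂ] H' :=
    T.equivRange.symm.toLinearIsometry.comp ⟨Submodule.inclusion hV', fun x => rfl⟩
  have hS : ∀ v : V', T (S v) = v := fun v =>
    congrArg Subtype.val (T.equivRange.apply_symm_apply ⟨v, hV' v.2⟩)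
  let K : H →ₗ[ℂ] H' := S.toLinearMap ∘ₗ V'.orthogonalProjectionOnto.toLinearMap +
    W.subtype ∘ₗ J.toLinearMap ∘ₗ (V'ᗮ).orthogonalProjectionOnto.toLinearMap
  have hK : ∀ x, K x = S (V'.orthogonalProjectionOnto x) + J ((V'ᗮ).orthogonalProjectionOnto x) :=
    fun x => rfl
  refine ⟨⟨K, fun x => ?_⟩, fun v hv => ?_⟩
  · have h0 : inner ℂ (S (V'.orthogonalProjectionOnto x))
        (J ((V'ᗮ).orthogonalProjectionOnto x) : H') = 0 := by
      rw [← T.inner_map_map, hS]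
      exact (J ((V'ᗮ).orthogonalProjectionOnto x)).2 _ (V'.orthogonalProjectionOnto x).2
    have h1 := norm_add_sq_eq_norm_sq_add_norm_sq_of_inner_eq_zero _ _ h0
    have h2 := V'.norm_sq_eq_add_norm_sq_projection x
    rw [hK, ← sq_eq_sq₀ (norm_nonneg _) (norm_nonneg _), h2, pow_two, h1, S.norm_map,
      ← Submodule.coe_norm, J.norm_map, pow_two, pow_two]
  · have hv' : v ∈ V' := V.le_topologicalClosure hv
    change T (K v) = v
    rw [hK, map_add, hS]
    rw [V'.orthogonalProjectionOnto_mem_subspace_eq_self ⟨v, hv'⟩,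
      Submodule.orthogonalProjectionOnto_apply_of_mem_orthogonal
        (V'.le_orthogonal_orthogonal hv'), map_zero]
    simp

/-! ### The path measure: existence and uniqueness -/

theorem measurable_coord {N : ℕ} (n : ℕ) : Measurable (coord (N := N) n) :=
  (measurable_pi_apply n).comp measurable_subtype_coe

/-- The real line inside the solenoid: `t ↦ (t, t / N, t / N², …)` modulo `1`. -/
def solenoidLine {N : ℕ} (hN : N ≠ 0) (t : ℝ) : Solenoid N :=
  ⟨fun n => ((t / (N : ℝ) ^ n : ℝ) : UnitAddCircle), fun n => by
    have : (N : ℝ) ≠ 0 := Nat.cast_ne_zero.2 hN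
    rw [← AddCircle.coe_nsmul, nsmul_eq_mul]
    congr 1
    rw [pow_succ, mul_comm, div_mul, mul_div_assoc, div_self this, mul_one]⟩

theorem coord_solenoidLine {N : ℕ} (hN : N ≠ 0) (n : ℕ) (t : ℝ) :
    coord n (solenoidLine hN t) = ((t / (N : ℝ) ^ n : ℝ) : UnitAddCircle) := rfl

theorem measurable_solenoidLine {N : ℕ} (hN : N ≠ 0) : Measurable (solenoidLine hN) :=
  Measurable.subtype_mk (measurable_pi_lambda _ fun _ =>
    AddCircle.measurable_mk'.comp (measurable_id.div_const _))

/-- The measure `|ψ(t)|² dt`. -/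
def sqDensity (ψ : Lp ℂ 2 (volume : Measure ℝ)) : Measure ℝ :=
  volume.withDensity fun t => ‖ψ t‖ₑ ^ 2

theorem measurable_Lp_real (ψ : Lp ℂ 2 (volume : Measure ℝ)) : Measurable ψ :=
  (Lp.stronglyMeasurable ψ).measurable

theorem isProbabilityMeasure_sqDensity {ψ : Lp ℂ 2 (volume : Measure ℝ)} (hψ : ‖ψ‖ = 1) :
    IsProbabilityMeasure (sqDensity ψ) := by
  constructor
  rw [sqDensity, withDensity_apply _ MeasurableSet.univ, setLIntegral_univ]
  have h := eLpNorm_nnreal_pow_eq_lintegral (p := 2) (f := ψ) (μ := volume) two_ne_zero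
  simp only [NNReal.coe_ofNat, ENNReal.rpow_ofNat, ENNReal.coe_ofNat] at h
  rw [← h, ← Lp.enorm_def, ← ofReal_norm, hψ]
  simp

/-- The lift to the line of the iterated transfer operator expression. -/
def nestedLine (N : ℕ) (m₀ : UnitAddCircle → ℂ) (G : ℝ → ℝ≥0∞) :
    ℕ → (ℕ → UnitAddCircle → ℝ≥0∞) → ℝ → ℝ≥0∞
  | 0, f => fun x => f 0 x * G x
  | n + 1, f => fun x => f 0 x * ((N : ℝ≥0∞)⁻¹ * (‖m₀ ((x / N : ℝ) : UnitAddCircle)‖ₑ ^ 2 *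
      nestedLine N m₀ G n (fun k => f (k + 1)) (x / N)))

theorem nested_periodize {N : ℕ} (hN : N ≠ 0) (m₀ : UnitAddCircle → ℂ) (G : ℝ → ℝ≥0∞) (n : ℕ)
    (f : ℕ → UnitAddCircle → ℝ≥0∞) :
    nested (transferOp N m₀) (periodize G) n f = periodize (nestedLine N m₀ G n f) := by
  induction n generalizing f with
  | zero => exact funext fun t => mul_periodize (f 0) G t
  | succ n ih =>
    funext t
    simp only [nested, ih, transferOp_periodize hN, mul_periodize, nestedLine]

/-- The invariance of `G` absorbs one weight `N⁻¹ |m₀|²` at each level, leaving only the product of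
the `f i`. -/
theorem nestedLine_ae_eq {N : ℕ} (hN : N ≠ 0) {m₀ : UnitAddCircle → ℂ} {G : ℝ → ℝ≥0∞}
    (hG : (fun x => (N : ℝ≥0∞)⁻¹ * (‖m₀ ((x / N : ℝ) : UnitAddCircle)‖ₑ ^ 2 * G (x / N)))
      =ᵐ[volume] G) (n : ℕ) (f : ℕ → UnitAddCircle → ℝ≥0∞) :
    nestedLine N m₀ G n f =ᵐ[volume] fun x =>
      (∏ i ∈ Finset.range (n + 1), f i ((x / (N : ℝ) ^ i : ℝ) : UnitAddCircle)) * G x := by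
  induction n generalizing f with
  | zero => simp [nestedLine]
  | succ n ih =>
    filter_upwards [hG, (quasiMeasurePreserving_div (Nat.cast_ne_zero.2 hN)).ae
      (ih fun k => f (k + 1))] with x e1 e2
    simp only [nestedLine]
    rw [e2, Finset.prod_range_succ' _ (n + 1), pow_zero, div_one, ← e1]
    simp only [pow_succ', div_div]
    ring

theorem IsScalingFunction.enorm_hat_sq {N : ℕ} (hN : N ≠ 0) {a : ℤ → ℂ} {m₀ : UnitAddCircle → ℂ}
    {φ : Lp ℂ 2 (volume : Measure ℝ)} (hφ : IsScalingFunction N a m₀ φ) :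
    (fun x : ℝ => (N : ℝ≥0∞)⁻¹ *
      (‖m₀ ((x / N : ℝ) : UnitAddCircle)‖ₑ ^ 2 * ‖hat φ (x / N)‖ₑ ^ 2))
      =ᵐ[volume] fun x => ‖hat φ x‖ₑ ^ 2 := by
  filter_upwards [hφ.hat_eq hN] with x e
  have h : ‖(√(N : ℝ) : ℂ)⁻¹‖ₑ ^ 2 = (N : ℝ≥0∞)⁻¹ := by
    rw [← ofReal_norm, ← ENNReal.ofReal_pow (norm_nonneg _), norm_inv, Complex.norm_real,
      Real.norm_of_nonneg (Real.sqrt_nonneg _), inv_pow, Real.sq_sqrt (Nat.cast_nonneg _),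
      ENNReal.ofReal_inv_of_pos (by positivity), ENNReal.ofReal_natCast]
  rw [e, enorm_mul, enorm_mul, mul_pow, mul_pow, h, mul_assoc]

theorem hPhi_eq_periodize (φ : Lp ℂ 2 (volume : Measure ℝ)) :
    hPhi φ = periodize fun x => ‖hat φ x‖ₑ ^ 2 := rfl

theorem IsScalingFunction.transferOp_hPhi {N : ℕ} (hN : N ≠ 0) {a : ℤ → ℂ}
    {m₀ : UnitAddCircle → ℂ} {φ : Lp ℂ 2 (volume : Measure ℝ)}
    (hφ : IsScalingFunction N a m₀ φ) : transferOp N m₀ (hPhi φ) =ᵐ[volume] hPhi φ := by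
  rw [hPhi_eq_periodize, transferOp_periodize hN]
  exact periodize_ae_congr (hφ.enorm_hat_sq hN)

theorem norm_hat (φ : Lp ℂ 2 (volume : Measure ℝ)) : ‖hat φ‖ = ‖φ‖ :=
  (Lp.fourierTransformₗᵢ ℝ ℂ).symm.norm_map φ

theorem IsScalingFunction.isPathMeasure {N : ℕ} (hN : N ≠ 0) {a : ℤ → ℂ}
    {m₀ : UnitAddCircle → ℂ} {φ : Lp ℂ 2 (volume : Measure ℝ)}
    (hφ : IsScalingFunction N a m₀ φ) :
    IsPathMeasure N (transferOp N m₀) (hPhi φ)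
      ((sqDensity (hat φ)).map (solenoidLine hN)) := by
  have := isProbabilityMeasure_sqDensity ((norm_hat φ).trans hφ.norm_eq_one)
  refine ⟨Measure.isProbabilityMeasure_map (measurable_solenoidLine hN).aemeasurable,
    fun n f hf => ?_⟩
  have hd : Measurable fun x : ℝ => ‖hat φ x‖ₑ ^ 2 := (measurable_Lp_real _).enorm.pow_const 2
  have hp : Measurable fun x : ℝ =>
      ∏ i ∈ Finset.range (n + 1), f i ((x / (N : ℝ) ^ i : ℝ) : UnitAddCircle) :=
    Finset.measurable_fun_prod _ fun i _ =>
      (hf i).comp (AddCircle.measurable_mk'.comp (measurable_id.div_const _))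
  rw [hPhi_eq_periodize, nested_periodize hN,
    lintegral_congr_ae (periodize_ae_congr (nestedLine_ae_eq hN (hφ.enorm_hat_sq hN) n f)),
    lintegral_periodize (G := fun x => (∏ i ∈ Finset.range (n + 1), _) * _) (hp.mul hd),
    lintegral_map (f := fun ω => ∏ i ∈ Finset.range (n + 1), f i (coord i ω))
      (Finset.measurable_fun_prod _ fun i _ => (hf i).comp (measurable_coord i))
      (measurable_solenoidLine hN)]
  simp only [coord_solenoidLine]
  rw [sqDensity, lintegral_withDensity_eq_lintegral_mul _ hd hp]
  simp only [Pi.mul_apply, mul_comm]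

/-- Taking indicators for the `f i` determines the measure of square cylinders, a π-system
generating the cylinder σ-algebra. -/
theorem IsPathMeasure.eq {N : ℕ} {R : (UnitAddCircle → ℝ≥0∞) → (UnitAddCircle → ℝ≥0∞)}
    {h : UnitAddCircle → ℝ≥0∞} {P Q : Measure (Solenoid N)} (hP : IsPathMeasure N R h P)
    (hQ : IsPathMeasure N R h Q) : P = Q := by
  have := hP.prob
  have := hQ.prob
  have hval : Measurable (Subtype.val : Solenoid N → ℕ → UnitAddCircle) := measurable_subtype_coe
  have key : ∀ P' : Measure (Solenoid N), IsPathMeasure N R h P' → ∀ (s : Finset ℕ)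
      (t : ℕ → Set UnitAddCircle), (∀ i, MeasurableSet (t i)) →
      P'.map Subtype.val ((s : Set ℕ).pi t) = ∫⁻ x : UnitAddCircle, nested R h (s.sup id)
        (fun i => if i ∈ s then (t i).indicator 1 else 1) x := by
    intro P' hP' s t ht
    have hS : MeasurableSet ((s : Set ℕ).pi t) :=
      MeasurableSet.pi s.countable_toSet fun i _ => ht i
    rw [← hP'.path (s.sup id) _ fun i => by
        split_ifs
        exacts [measurable_one.indicator (ht i), measurable_one],
      Measure.map_apply hval hS, ← lintegral_indicator_one (hval hS)]
    refine lintegral_congr fun ω => ?_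
    -- The path formula wants consecutive indices from `0`; those outside `s` carry the constant
    -- `1`.
    have hsub : s ⊆ Finset.range (s.sup id + 1) := fun i hi =>
      Finset.mem_range_succ_iff.2 (Finset.le_sup (f := id) hi)
    rw [← Finset.prod_subset hsub fun i _ hi => by rw [if_neg hi, Pi.one_apply],
      Finset.prod_congr rfl fun i hi => by rw [if_pos hi]]
    by_cases hω : ω ∈ (Subtype.val : Solenoid N → ℕ → UnitAddCircle) ⁻¹' ((s : Set ℕ).pi t)
    · rw [Set.indicator_of_mem hω, Finset.prod_eq_one fun i hi =>
        Set.indicator_of_mem (hω i hi) 1, Pi.one_apply]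
    · rw [Set.indicator_of_notMem hω]
      have : ∃ i ∈ s, ω.1 i ∉ t i := by
        simpa [Set.mem_pi] using hω
      obtain ⟨i, hi, hit⟩ := this
      exact (Finset.prod_eq_zero hi (Set.indicator_of_notMem hit 1)).symm
  have hmap : P.map Subtype.val = Q.map (Subtype.val : Solenoid N → ℕ → UnitAddCircle) := by
    have := Measure.isProbabilityMeasure_map (μ := P) hval.aemeasurable
    have := Measure.isProbabilityMeasure_map (μ := Q) hval.aemeasurable
    refine ext_of_generate_finite _ generateFrom_squareCylinders.symm
      (isPiSystem_squareCylinders (fun _ => MeasurableSpace.isPiSystem_measurableSet)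
        fun _ => Set.mem_ofPred_eq.mpr MeasurableSet.univ) ?_ (by simp)
    rintro _ ⟨s, t, ht, rfl⟩
    rw [key P hP s t fun i => ht i trivial, key Q hQ s t fun i => ht i trivial]
  refine Measure.ext fun S hS => ?_
  obtain ⟨S', hS', rfl⟩ := hS
  rw [← Measure.map_apply hval hS', hmap, Measure.map_apply hval hS']

/-! ### The isometry from `L²(P)` into `L²(ℝ)` and its range -/

theorem eLpNorm_mul_eq_sqDensity (ψ : Lp ℂ 2 (volume : Measure ℝ)) {g : ℝ → ℂ}
    (hg : Measurable g) :
    eLpNorm (fun x => g x * ψ x) 2 volume = eLpNorm g 2 (sqDensity ψ) := by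
  have h1 := eLpNorm_nnreal_pow_eq_lintegral (p := 2) (f := fun x => g x * ψ x)
    (μ := volume) two_ne_zero
  have h2 := eLpNorm_nnreal_pow_eq_lintegral (p := 2) (f := g) (μ := sqDensity ψ) two_ne_zero
  rw [sqDensity, lintegral_withDensity_eq_lintegral_mul _
    ((measurable_Lp_real ψ).enorm.pow_const 2) (hg.enorm.pow_const _)] at h2
  have h3 := h1.trans ((lintegral_congr fun x => ?_).trans h2.symm)
  · simp only [NNReal.coe_ofNat, ENNReal.rpow_ofNat, ENNReal.coe_ofNat] at h3
    exact (ENNReal.pow_right_strictMono two_ne_zero).injective h3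
  · simp only [NNReal.coe_ofNat, ENNReal.rpow_ofNat, Pi.mul_apply, enorm_mul, mul_pow, mul_comm]

/-- The weighted measure does not see the zeros of `ψ`; the later products with `ψ` vanish there
anyway. -/
theorem ae_of_ae_map_sqDensity {ψ : Lp ℂ 2 (volume : Measure ℝ)} {X : Type*} [MeasurableSpace X]
    {j : ℝ → X} (hj : Measurable j) {p : X → Prop}
    (h : ∀ᵐ ω ∂(sqDensity ψ).map j, p ω) : ∀ᵐ x : ℝ, ψ x ≠ 0 → p (j x) := by
  have h1 := ae_of_ae_map hj.aemeasurable h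
  rw [sqDensity, ae_withDensity_iff ((measurable_Lp_real ψ).enorm.pow_const 2)] at h1
  filter_upwards [h1] with x hx h0
  exact hx (pow_ne_zero 2 (enorm_ne_zero.2 h0))

/-- Pulling back along `j` and multiplying by `ψ` is an isometry into `L²(ℝ)`. -/
theorem exists_pullback (ψ : Lp ℂ 2 (volume : Measure ℝ)) {X : Type*} [MeasurableSpace X]
    {j : ℝ → X} (hj : Measurable j) :
    ∃ T : Lp ℂ 2 ((sqDensity ψ).map j) →ₗᵢ[ℂ] Lp ℂ 2 (volume : Measure ℝ),
      ∀ F, T F =ᵐ[volume] fun x => F (j x) * ψ x := by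
  have hF (F : Lp ℂ 2 ((sqDensity ψ).map j)) : Measurable F := (Lp.stronglyMeasurable F).measurable
  have hn (F : Lp ℂ 2 ((sqDensity ψ).map j)) :
      eLpNorm (fun x => F (j x) * ψ x) 2 volume = eLpNorm F 2 ((sqDensity ψ).map j) := by
    rw [eLpNorm_map_measure (hF F).aestronglyMeasurable hj.aemeasurable,
      eLpNorm_mul_eq_sqDensity ψ (g := fun x => F (j x)) ((hF F).comp hj)]
    rfl
  have hm (F : Lp ℂ 2 ((sqDensity ψ).map j)) : MemLp (fun x => F (j x) * ψ x) 2 volume :=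
    ⟨(((hF F).comp hj).mul (measurable_Lp_real ψ)).aestronglyMeasurable,
      by rw [hn]; exact (Lp.memLp F).2⟩
  refine ⟨⟨⟨⟨fun F => (hm F).toLp, fun F G => ?_⟩, fun c F => ?_⟩, fun F => ?_⟩,
    fun F => (hm F).coeFn_toLp⟩
  · refine Lp.ext ?_
    filter_upwards [(hm (F + G)).coeFn_toLp, (hm F).coeFn_toLp, (hm G).coeFn_toLp,
      Lp.coeFn_add (hm F).toLp (hm G).toLp, ae_of_ae_map_sqDensity hj (Lp.coeFn_add F G)]
      with x h1 h2 h3 h4 h5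
    rw [h1, h4, Pi.add_apply, h2, h3]
    by_cases h0 : ψ x = 0
    · simp [h0]
    · rw [h5 h0, Pi.add_apply, add_mul]
  · refine Lp.ext ?_
    filter_upwards [(hm (c • F)).coeFn_toLp, (hm F).coeFn_toLp,
      Lp.coeFn_smul c (hm F).toLp, ae_of_ae_map_sqDensity hj (Lp.coeFn_smul c F)]
      with x h1 h2 h4 h5
    change (hm (c • F)).toLp _ x = (c • (hm F).toLp _ : Lp ℂ 2 (volume : Measure ℝ)) x
    rw [h1, h4, Pi.smul_apply, h2]
    by_cases h0 : ψ x = 0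
    · simp [h0]
    · rw [h5 h0, Pi.smul_apply, smul_eq_mul, smul_eq_mul, mul_assoc]
  · change ‖(hm F).toLp _‖ = ‖F‖
    rw [Lp.norm_toLp, hn, Lp.norm_def]

theorem exists_preimage_pullback {ψ : Lp ℂ 2 (volume : Measure ℝ)} {X : Type*}
    [MeasurableSpace X] {j : ℝ → X} (hj : Measurable j)
    {T : Lp ℂ 2 ((sqDensity ψ).map j) →ₗᵢ[ℂ] Lp ℂ 2 (volume : Measure ℝ)}
    (hT : ∀ F, T F =ᵐ[volume] fun x => F (j x) * ψ x) {G : X → ℂ} (hG : Measurable G)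
    {g : Lp ℂ 2 (volume : Measure ℝ)} (hg : g =ᵐ[volume] fun x => G (j x) * ψ x) :
    ∃ F, T F = g ∧ F =ᵐ[(sqDensity ψ).map j] G := by
  have hm : MemLp G 2 ((sqDensity ψ).map j) := by
    refine ⟨hG.aestronglyMeasurable, ?_⟩
    rw [eLpNorm_map_measure hG.aestronglyMeasurable hj.aemeasurable,
      ← eLpNorm_mul_eq_sqDensity ψ (hG.comp hj)]
    exact (eLpNorm_congr_ae hg).symm.trans_lt (Lp.memLp g).2
  refine ⟨hm.toLp, Lp.ext ?_, hm.coeFn_toLp⟩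
  filter_upwards [hT hm.toLp, hg, ae_of_ae_map_sqDensity hj hm.coeFn_toLp] with x h1 h2 h3
  rw [h1, h2]
  by_cases h0 : ψ x = 0
  · simp [h0]
  · rw [h3 h0]

/-- For `N ^ n > |t - s|`, equality of the `n`-th coordinates makes `(t - s) / N ^ n` an integer of
absolute value below 1. -/
theorem solenoidLine_injective {N : ℕ} (hN : 2 ≤ N) :
    Function.Injective (solenoidLine (N := N) (by omega)) := by
  intro t s hts
  have hN1 : (1 : ℝ) < N := by exact_mod_cast hN
  obtain ⟨n, hn⟩ := pow_unbounded_of_one_lt |t - s| hN1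
  have hp : (0 : ℝ) < (N : ℝ) ^ n := by positivity
  have h : ((t / (N : ℝ) ^ n : ℝ) : UnitAddCircle) = ((s / (N : ℝ) ^ n : ℝ) : UnitAddCircle) :=
    congrArg (coord n) hts
  rw [← sub_eq_zero, ← AddCircle.coe_sub, AddCircle.coe_eq_zero_iff] at h
  obtain ⟨k, hk⟩ := h
  rw [zsmul_eq_mul, mul_one, ← sub_div] at hk
  have hk1 : |(k : ℝ)| < 1 := by
    rw [hk, abs_div, abs_of_pos hp, div_lt_one hp]; exact hn
  have hk0 : k = 0 := Int.abs_lt_one_iff.1 (by exact_mod_cast hk1)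
  rw [hk0, Int.cast_zero, eq_comm, div_eq_zero_iff, or_iff_left hp.ne', sub_eq_zero] at hk
  exact hk

/-- Needed for the Lusin–Souslin theorem, which turns the injective measurable line into a
measurable embedding. -/
instance (N : ℕ) : MeasurableSpace.CountablySeparated (Solenoid N) :=
  inferInstanceAs (MeasurableSpace.CountablySeparated
    ({x : ℕ → UnitAddCircle | ∀ n, N • x (n + 1) = x n} : Set (ℕ → UnitAddCircle)))

theorem measurableEmbedding_solenoidLine {N : ℕ} (hN : 2 ≤ N) :
    MeasurableEmbedding (solenoidLine (N := N) (by omega)) :=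
  (measurable_solenoidLine _).measurableEmbedding (solenoidLine_injective hN)

/-! ### Infinitely many orthogonal directions outside `V₀` -/

/-- A non-null set for an atomless measure contains infinitely many disjoint non-null sets. -/
theorem exists_seq_disjoint_measure_ne_zero {B : Set ℝ} (hB : MeasurableSet B)
    (h0 : volume B ≠ 0) :
    ∃ A : ℕ → Set ℝ, (∀ n, MeasurableSet (A n)) ∧ (∀ n, A n ⊆ B) ∧ (∀ n, volume (A n) ≠ 0) ∧
      Pairwise fun i k => Disjoint (A i) (A k) := by
  set C := (volume.restrict B).support with hC
  have hCm : MeasurableSet C := Measure.isClosed_support.measurableSet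
  have hCc : volume.restrict B Cᶜ = 0 := Measure.measure_compl_support
  -- A finite support would be null. An infinite Hausdorff space has infinitely many disjoint
  -- nonempty open sets, and those of `C` are non-null because their points lie in the support.
  have hinf : Set.Infinite C := fun hfin => h0 <| by
    rw [← Measure.restrict_apply_univ, ← Set.union_compl_self C]
    exact measure_union_null (Measure.absolutelyContinuous_of_le Measure.restrict_le_self
      (hfin.measure_zero volume)) hCc
  have : Infinite C := hinf.to_subtype
  obtain ⟨U, hU, hUo, hUd⟩ := exists_seq_infinite_isOpen_pairwise_disjoint C
  choose V hVo hV using fun n => isOpen_induced_iff.1 (hUo n)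
  refine ⟨fun n => V n ∩ C ∩ B, fun n => (((hVo n).measurableSet.inter hCm).inter hB),
    fun n => Set.inter_subset_right, fun n hn => ?_, fun i k hik => ?_⟩
  · obtain ⟨x, hx⟩ := (hU n).nonempty
    have hxV : x.1 ∈ V n := by rw [← hV n] at hx; exact hx
    have h1 := (Measure.mem_support_iff_forall x.1).1 x.2 (V n) ((hVo n).mem_nhds hxV)
    rw [← Measure.restrict_apply ((hVo n).measurableSet.inter hCm)] at hn
    refine h1.ne' (measure_mono_null (t := (V n ∩ C) ∪ Cᶜ) (fun y hy => ?_)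
      (measure_union_null hn hCc))
    by_cases hyC : y ∈ C
    exacts [Or.inl ⟨hy, hyC⟩, Or.inr hyC]
  · refine Set.disjoint_left.2 ?_
    rintro x ⟨⟨hx, hxC⟩, -⟩ ⟨⟨hx', -⟩, -⟩
    have h1 : (⟨x, hxC⟩ : C) ∈ U i := by rw [← hV i]; exact hx
    have h2 : (⟨x, hxC⟩ : C) ∈ U k := by rw [← hV k]; exact hx'
    exact Set.disjoint_left.1 (hUd hik : Disjoint (U i) (U k)) h1 h2

/-- Blichfeldt's principle. If all overlaps were null, deleting them would leave a set of measure
above 1, which still contains two points differing by a nonzero integer. -/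
theorem exists_int_measure_inter_translate_ne_zero {S : Set ℝ} (hS : MeasurableSet S)
    (h1 : 1 < volume S) :
    ∃ d : ℤ, d ≠ 0 ∧ volume (S ∩ (fun x : ℝ => x + d) ⁻¹' S) ≠ 0 := by
  by_contra! hcon
  set Z : Set ℝ := ⋃ d : {d : ℤ // d ≠ 0}, S ∩ (fun x : ℝ => x + (d : ℤ)) ⁻¹' S
  have hZ : volume Z = 0 := measure_iUnion_null fun d => hcon d d.2
  have hZm : MeasurableSet Z :=
    MeasurableSet.iUnion fun d => hS.inter (measurable_add_const _ hS)
  obtain ⟨⟨x, hx⟩, ⟨y, hy⟩, hxy, hd⟩ := exists_pair_mem_lattice_not_disjoint_vadd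
    (isAddFundamentalDomain_Ioc one_pos 0 (volume : Measure ℝ))
    (hS.diff hZm).nullMeasurableSet (by
      rw [measure_sdiff_null hZ]
      simpa using h1)
  obtain ⟨k, rfl⟩ := AddSubgroup.mem_zmultiples_iff.1 hx
  obtain ⟨l, rfl⟩ := AddSubgroup.mem_zmultiples_iff.1 hy
  obtain ⟨z, ⟨u, hu, hu'⟩, ⟨v, hv, hv'⟩⟩ := Set.not_disjoint_iff.1 hd
  have huv : u + ((k - l : ℤ) : ℝ) = v := by
    have h3 : (k • (1 : ℝ)) + u = l • (1 : ℝ) + v := hu'.trans hv'.symm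
    simp only [zsmul_eq_mul, mul_one] at h3
    push_cast
    linarith
  have hkl : k - l ≠ 0 := fun h => hxy (Subtype.ext
    (congrArg (fun m : ℤ => m • (1 : ℝ)) (sub_eq_zero.1 h)))
  exact hu.2 (Set.mem_iUnion.2 ⟨⟨k - l, hkl⟩, hu.1, by rw [Set.mem_preimage, huv]; exact hv.1⟩)

theorem exists_measure_inter_Ioc_ne_zero {B : Set ℝ} (h0 : volume B ≠ 0) :
    ∃ n : ℤ, volume (B ∩ Set.Ioc (n : ℝ) (n + 1)) ≠ 0 := by
  by_contra! hcon
  refine h0 (measure_mono_null (fun x hx => ?_) (measure_iUnion_null hcon))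
  have : x ∈ ⋃ n : ℤ, Set.Ioc (n : ℝ) (n + 1) := by rw [iUnion_Ioc_intCast]; trivial
  obtain ⟨n, hn⟩ := Set.mem_iUnion.1 this
  exact Set.mem_iUnion.2 ⟨n, hx, hn⟩

/-- The Fourier support of a scaling function with non-vanishing filter has infinite measure. -/
theorem IsScalingFunction.volume_support_hat {N : ℕ} (hN : 2 ≤ N) {a : ℤ → ℂ}
    {m₀ : UnitAddCircle → ℂ} {φ : Lp ℂ 2 (volume : Measure ℝ)}
    (hφ : IsScalingFunction N a m₀ φ) (hm : ∀ᵐ t : UnitAddCircle, m₀ t ≠ 0) :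
    volume {x : ℝ | hat φ x ≠ 0} = ∞ := by
  have hN0 : (0 : ℝ) < N := by positivity
  set S := {x : ℝ | hat φ x ≠ 0} with hS
  have h0 : volume S ≠ 0 := fun h => by
    have h2 : hat φ = 0 := by
      refine (Lp.eq_zero_iff_ae_eq_zero).2 ?_
      filter_upwards [measure_eq_zero_iff_ae_notMem.1 h] with x hx
      simpa [hS] using hx
    have h3 := norm_hat φ
    rw [h2, hφ.norm_eq_one, norm_zero] at h3
    exact zero_ne_one h3
  have hq := quasiMeasurePreserving_coe_unitAddCircle.comp (quasiMeasurePreserving_div hN0.ne')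
  have he : (S : Set ℝ) =ᵐ[volume] ((fun x => (N : ℝ)⁻¹ * x) ⁻¹' S : Set ℝ) := by
    rw [eventuallyEq_set]
    filter_upwards [hφ.hat_eq (by omega), hq.ae hm] with x h1 h2
    rw [Set.mem_preimage, hS, Set.mem_ofPred_eq, Set.mem_ofPred_eq, h1,
      inv_mul_eq_div (N : ℝ) x, mul_ne_zero_iff, mul_ne_zero_iff]
    have h3 : (√(N : ℝ) : ℂ)⁻¹ ≠ 0 :=
      inv_ne_zero (Complex.ofReal_ne_zero.2 (Real.sqrt_pos.2 hN0).ne')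
    exact ⟨fun h => h.2, fun h => ⟨⟨h3, h2⟩, h⟩⟩
  have hv := measure_congr he
  rw [Real.volume_preimage_mul_left (inv_ne_zero hN0.ne'), inv_inv, abs_of_pos hN0,
    ENNReal.ofReal_natCast] at hv
  by_contra htop
  -- Dilation invariance gives `|S| = N |S|`; with `0 < |S| < ∞` this would force `N = 1`.
  have h4 : (1 : ℝ≥0∞) * volume S = N * volume S := by rw [one_mul]; exact hv
  have h5 := (ENNReal.mul_left_inj h0 htop).1 h4
  have : (1 : ℕ) = N := by exact_mod_cast h5
  omega

/-- A function concentrated on `A` and on its translate by `d`, orthogonal to all periodic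
multiples of `ψ`. -/
def twoBump (ψ : ℝ → ℂ) (d : ℝ) (A : Set ℝ) (x : ℝ) : ℂ :=
  A.indicator (fun y => star (ψ (y + d))) x - A.indicator (fun y => star (ψ y)) (x - d)

/-- Against `f φ̂`, each bump contributes the integral over `A` of the conjugate of `f(x) φ̂(x) φ̂(x
+ d)`, by periodicity of `f`; the opposite signs cancel. -/
theorem exists_orthogonal_twoBump (φ : Lp ℂ 2 (volume : Measure ℝ)) (d : ℤ) {A : Set ℝ}
    (hA : MeasurableSet A) :
    ∃ g ∈ (resolutionSpace φ)ᗮ, g =ᵐ[volume] twoBump (hat φ) d A := by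
  have hψ := Lp.memLp (hat φ)
  have m1 : MemLp (fun x : ℝ => A.indicator (fun y => star (hat φ (y + d))) x) 2 volume :=
    ((hψ.comp_measurePreserving (measurePreserving_add_right volume (d : ℝ))).star).indicator hA
  have m2 : MemLp (fun x : ℝ => A.indicator (fun y => star (hat φ y)) (x - d)) 2 volume :=
    (hψ.star.indicator hA).comp_measurePreserving (measurePreserving_sub_right volume (d : ℝ))
  refine ⟨m1.toLp - m2.toLp, ?_, ?_⟩
  · rw [Submodule.mem_orthogonal]
    rintro v ⟨f, hf, hv⟩
    rw [inner_sub_right, sub_eq_zero, L2.inner_def, L2.inner_def]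
    have e1 : ∫ x, inner ℂ (v x) ((m1.toLp : Lp ℂ 2 (volume : Measure ℝ)) x) =
        ∫ x : ℝ, inner ℂ (f (x : UnitAddCircle) * hat φ x)
          (A.indicator (fun y => star (hat φ (y + d))) x) :=
      integral_congr_ae (by filter_upwards [hv, m1.coeFn_toLp] with x h1 h2; rw [h1, h2])
    have e2 : ∫ x, inner ℂ (v x) ((m2.toLp : Lp ℂ 2 (volume : Measure ℝ)) x) =
        ∫ x : ℝ, inner ℂ (f (x : UnitAddCircle) * hat φ x)
          (A.indicator (fun y => star (hat φ y)) (x - d)) :=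
      integral_congr_ae (by filter_upwards [hv, m2.coeFn_toLp] with x h1 h2; rw [h1, h2])
    rw [e1, e2, ← integral_add_right_eq_self (μ := volume) (fun x : ℝ =>
      inner ℂ (f (x : UnitAddCircle) * hat φ x)
          (A.indicator (fun y => star (hat φ y)) (x - d))) (d : ℝ)]
    refine integral_congr_ae (.of_forall fun x => ?_)
    simp only [add_sub_cancel_right, coe_add_intCast_unitAddCircle]
    by_cases hx : x ∈ A
    · simp only [Set.indicator_of_mem hx, RCLike.inner_apply, map_mul, Complex.star_def]
      ring
    · simp only [Set.indicator_of_notMem hx, inner_zero_right]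
  · filter_upwards [Lp.coeFn_sub m1.toLp m2.toLp, m1.coeFn_toLp, m2.coeFn_toLp] with x h1 h2 h3
    rw [h1, Pi.sub_apply, h2, h3, twoBump]

theorem orthonormal_smul_inv_norm {ι H : Type*} [NormedAddCommGroup H] [InnerProductSpace ℂ H]
    {F : ι → H} (h0 : ∀ i, F i ≠ 0) (ho : Pairwise fun i k => inner ℂ (F i) (F k) = 0) :
    Orthonormal ℂ fun i => ((‖F i‖ : ℂ)⁻¹ • F i) :=
  ⟨fun i => norm_smul_inv_norm (h0 i), fun i k hik => by
    simp only [inner_smul_left, inner_smul_right, ho hik, mul_zero]⟩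

/-- If the support of `φ̂` has measure greater than `1`, there is an infinite orthonormal sequence in
the orthogonal complement of the resolution space, made of functions vanishing where `φ̂` does. -/
theorem exists_orthonormal_orthogonal_resolutionSpace {φ : Lp ℂ 2 (volume : Measure ℝ)}
    (h : 1 < volume {x : ℝ | hat φ x ≠ 0}) :
    ∃ e : ℕ → Lp ℂ 2 (volume : Measure ℝ), Orthonormal ℂ e ∧
      (∀ n, e n ∈ (resolutionSpace φ)ᗮ) ∧ ∀ n, ∀ᵐ x : ℝ, hat φ x = 0 → e n x = 0 := by
  have hSm : MeasurableSet {x : ℝ | hat φ x ≠ 0} :=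
    (measurable_Lp_real (hat φ)) (measurableSet_singleton 0).compl
  obtain ⟨d, hd, h1⟩ := exists_int_measure_inter_translate_ne_zero hSm h
  obtain ⟨n, h2⟩ := exists_measure_inter_Ioc_ne_zero h1
  obtain ⟨A, hAm, hAB, hA0, hAd⟩ := exists_seq_disjoint_measure_ne_zero
    ((hSm.inter (measurable_add_const _ hSm)).inter measurableSet_Ioc) h2
  -- All the `A i` lie in one half-open unit interval, so a translation by `d ≠ 0` moves each off
  -- all of them.
  have hsep : ∀ i k x, x ∈ A i → x - d ∉ A k := fun i k x hx hx' => by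
    have h3 := (hAB i hx).2
    have h4 := (hAB k hx').2
    have h5 : |(d : ℝ)| < 1 := by
      rw [abs_lt]; constructor <;> linarith [h3.1, h3.2, h4.1, h4.2]
    exact hd (Int.abs_lt_one_iff.1 (by exact_mod_cast h5))
  choose F hFo hF using fun k => exists_orthogonal_twoBump φ d (hAm k)
  have hz : ∀ k x, x ∉ A k → x - d ∉ A k → twoBump (hat φ) d (A k) x = 0 := fun k x h1 h2 => by
    rw [twoBump, Set.indicator_of_notMem h1, Set.indicator_of_notMem h2, sub_zero]
  have hF0 : ∀ k, F k ≠ 0 := fun k h0 => hA0 k <| by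
    rw [measure_eq_zero_iff_ae_notMem]
    filter_upwards [hF k, (Lp.eq_zero_iff_ae_eq_zero).1 h0] with x e1 e2 hx
    rw [e2, twoBump, Set.indicator_of_mem hx, Set.indicator_of_notMem (hsep k k x hx), sub_zero,
      Pi.zero_apply, eq_comm, star_eq_zero] at e1
    exact (hAB k hx).1.2 e1
  have ho : Pairwise fun i k => inner ℂ (F i) (F k) = 0 := fun i k hik => by
    refine (L2.inner_def (𝕜 := ℂ) (F i) (F k)).trans ?_
    rw [integral_congr_ae (g := 0), Pi.zero_def, integral_zero]
    filter_upwards [hF i, hF k] with x e1 e2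
    rw [e1, e2, Pi.zero_apply]
    have hdis : ∀ y, y ∈ A i → y ∉ A k := fun y hy =>
      Set.disjoint_left.1 (hAd hik : Disjoint (A i) (A k)) hy
    by_cases h3 : x ∈ A i
    · rw [hz k x (hdis x h3) (hsep i k x h3), inner_zero_right]
    by_cases h4 : x - d ∈ A i
    · rw [hz k x (fun h5 => hsep k i x h5 h4) (hdis _ h4), inner_zero_right]
    · rw [hz i x h3 h4, inner_zero_left]
  refine ⟨_, orthonormal_smul_inv_norm hF0 ho, fun k => Submodule.smul_mem _ _ (hFo k),
    fun k => ?_⟩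
  filter_upwards [Lp.coeFn_smul (‖F k‖ : ℂ)⁻¹ (F k), hF k] with x e1 e2 hx
  rw [e1, Pi.smul_apply, e2, hz k x (fun h3 => (hAB k h3).1.1 hx) (fun h3 => ?_), smul_zero]
  have := (hAB k h3).1.2
  rw [Set.mem_preimage, sub_add_cancel] at this
  exact this hx

end

/-! ### Construction of `K₀` and its extension -/

theorem mainTheorem11 (N : ℕ) (hN : 2 ≤ N) (a : ℤ → ℂ) (m₀ : UnitAddCircle → ℂ)
    (φ : Lp ℂ 2 (volume : Measure ℝ)) (hφ : IsScalingFunction N a m₀ φ) :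
    (transferOp N m₀ (hPhi φ) =ᵐ[volume] hPhi φ) ∧
    (∃! P : Measure (Solenoid N), IsPathMeasure N (transferOp N m₀) (hPhi φ) P) ∧
    ∀ P : Measure (Solenoid N), IsPathMeasure N (transferOp N m₀) (hPhi φ) P →
      ∃ K₀ : resolutionSpace φ →ₗᵢ[ℂ] Lp ℂ 2 P,
        (∀ (f : UnitAddCircle → ℂ), Measurable f → ∀ g : resolutionSpace φ,
          ((g : Lp ℂ 2 (volume : Measure ℝ)) =ᵐ[volume]
            fun t : ℝ => f (t : UnitAddCircle) * hat φ t) →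
          K₀ g =ᵐ[P] fun ω => f (coord 0 ω)) ∧
        ((∀ᵐ t : UnitAddCircle, m₀ t ≠ 0) →
          ∃ K : Lp ℂ 2 (volume : Measure ℝ) →ₗᵢ[ℂ] Lp ℂ 2 P,
            ∀ g : resolutionSpace φ, K (g : Lp ℂ 2 (volume : Measure ℝ)) = K₀ g) := by
  have hN0 : N ≠ 0 := by omega
  have hpath := hφ.isPathMeasure hN0
  refine ⟨hφ.transferOp_hPhi hN0, ⟨_, hpath, fun P hP => hP.eq hpath⟩, fun P hP => ?_⟩
  obtain rfl := hP.eq hpath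
  have hj := measurable_solenoidLine hN0
  obtain ⟨T, hT⟩ := exists_pullback (hat φ) hj
  have hpre (f : UnitAddCircle → ℂ) (hf : Measurable f) (g : Lp ℂ 2 (volume : Measure ℝ))
      (hg : g =ᵐ[volume] fun t : ℝ => f (t : UnitAddCircle) * hat φ t) :
      ∃ F, T F = g ∧
        F =ᵐ[(sqDensity (hat φ)).map (solenoidLine hN0)] fun ω => f (coord 0 ω) :=
    exists_preimage_pullback hj hT (hf.comp (measurable_coord 0)) (by
      simpa only [Function.comp_apply, coord_solenoidLine, pow_zero, div_one] using hg)
  have hV : resolutionSpace φ ≤ T.range := by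
    rintro g ⟨f, hf, hg⟩
    obtain ⟨F, hF, -⟩ := hpre f hf g hg
    exact ⟨F, hF⟩
  let K₀ : resolutionSpace φ →ₗᵢ[ℂ] Lp ℂ 2 ((sqDensity (hat φ)).map (solenoidLine hN0)) :=
    T.equivRange.symm.toLinearIsometry.comp ⟨Submodule.inclusion hV, fun x => rfl⟩
  have hK₀ : ∀ g : resolutionSpace φ, T (K₀ g) = g := fun g =>
    congrArg Subtype.val (T.equivRange.apply_symm_apply ⟨g, hV g.2⟩)
  refine ⟨K₀, fun f hf g hg => ?_, fun hm => ?_⟩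
  · obtain ⟨F, hF, hFf⟩ := hpre f hf g hg
    rwa [T.injective ((hK₀ g).trans hF.symm)]
  · obtain ⟨e, he, heV, he0⟩ := exists_orthonormal_orthogonal_resolutionSpace (φ := φ)
      (by rw [hφ.volume_support_hat hN hm]; exact ENNReal.one_lt_top)
    have hpre' (n : ℕ) : ∃ F, T F = e n := by
      -- The preimage of `e n` is the quotient `e n / φ̂` transported to the solenoid along the
      -- embedded line; where `φ̂` vanishes, so does `e n`.
      obtain ⟨G, hG, hGe⟩ := (measurableEmbedding_solenoidLine hN).exists_measurable_extend
        ((measurable_Lp_real (e n)).div (measurable_Lp_real (hat φ))) fun _ => ⟨0⟩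
      obtain ⟨F, hF, -⟩ := exists_preimage_pullback hj hT hG (g := e n) (by
        filter_upwards [he0 n] with x hx
        have h1 : G (solenoidLine hN0 x) = e n x / hat φ x := congrFun hGe x
        rw [h1]
        by_cases h0 : hat φ x = 0
        · rw [hx h0, h0, mul_zero]
        · rw [div_mul_cancel₀ _ h0])
      exact ⟨F, hF⟩
    choose F hF using hpre'
    have : Fact ((2 : ℝ≥0∞) ≠ ∞) := ⟨ENNReal.ofNat_ne_top⟩
    obtain ⟨K, hK⟩ := exists_linearIsometry_rightInverse T hV (e := F)
      (T.orthonormal_comp_iff.1 (by rwa [show T ∘ F = e from funext hF]))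
      fun n => by rw [hF]; exact heV n
    exact ⟨K, fun g => T.injective ((hK g g.2).trans (hK₀ g).symm)⟩
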